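/- Let $J(\star)^*=\mathbb F_2[x_0,x_1,x_2,\dots]$, bigraded as $\bigoplus_{n,d\ge 0}J(n)^d$ with $x_k\in J(2^k)^1$. Let the Steenrod squares $Sq^i$ act $\mathbb F_2$-linearly on $J(\star)^*$ as determined by $Sq^0=1$, the Cartan formula, the instability condition ($Sq^i f=0$ for $f\in J(n)^d$ and $i>d$), $Sq^1x_0=0$, and $Sq^1x_{k+1}=x_k^2$ for $k\ge 0$. Define operators $Q_m$ on $J(\star)^*$ by $Q_0=Sq^1$ and $Q_m=[Q_{m-1},Sq^{2^m}]$ for $m\ge 1$. Each $Q_m$ is a derivation with $Q_m^2=0$, so the Margolis homology $H(J(\star)^*;Q_m)=\ker Q_m/\operatorname{im}Q_m$ is a bigraded $\mathbb F_2$-algebra, with $H(J(n);Q_m)^d$ the space of classes of cycles in $J(n)^d$. Then, for every $m\ge 0$, the subalgebra $$R_m=\mathbb F_2[x_0,\dots,x_m,x_{m+1}^2,x_{m+2}^2,\dots]\subseteq J(\star)^*$$ is contained in $\ker Q_m$, and its inclusion induces an isomorphism of bigraded $\mathbb F_2$-algebras $$\mathbb F_2[x_0,\dots,x_m,x_{m+1}^2,x_{m+2}^2,\dots]\big/\bigl(x_k^{2^{m+1}}\mid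 k\ge 0\bigr)\;\xrightarrow{\ \cong\ }\;H(J(\star)^*;Q_m),$$ where the ideal is taken in $R_m$. -/

import Mathlib

namespace BrownGitler

noncomputable section

/-- The algebra `J(⋆)^* = ⨁ₙ J(n)`, with underlying algebra `𝔽₂[x₀, x₁, x₂, …]`; `x_k` is
`MvPolynomial.X k`. -/
abbrev J : Type := MvPolynomial ℕ (ZMod 2)

/-- The bigrading: `piece n d` is `J(n)^d`, the span of the monomials of bidegree `(n, d)`, where
`x_k` lies in `J(2^k)^1`. -/
def piece (n d : ℕ) : Submodule (ZMod 2) J :=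
  MvPolynomial.weightedHomogeneousSubmodule (ZMod 2) (fun k : ℕ => ((2 ^ k, 1) : ℕ × ℕ)) (n, d)

/-! ### The action of the Steenrod squares

By instability `Sq^i x_k = 0` for `i > 1`, so the total square `∑ Sq^i T^i` sends `x_k` to
`x_k + (Sq^1 x_k) T`, and by the Cartan formula it is multiplicative. -/

/-- `Sq^1 x_k`: it is `0` for `k = 0` and `x_{k-1}^2` for `k ≥ 1`. -/
def sqOneX : ℕ → J
  | 0 => 0
  | k + 1 => MvPolynomial.X k ^ 2

/-- The total Steenrod square `f ↦ ∑ᵢ Sq^i(f) T^i`. -/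
def totalSq : J →ₐ[ZMod 2] Polynomial J :=
  MvPolynomial.aeval fun k =>
    Polynomial.C (MvPolynomial.X k) + Polynomial.C (sqOneX k) * Polynomial.X

/-- The Steenrod square `Sq^i` on `J(⋆)^*`. -/
def sq (i : ℕ) : Module.End (ZMod 2) J :=
  (Polynomial.lcoeff J i).restrictScalars (ZMod 2) ∘ₗ totalSq.toLinearMap

theorem sq_apply (i : ℕ) (f : J) : sq i f = (totalSq f).coeff i := rfl

theorem totalSq_X (k : ℕ) : totalSq (MvPolynomial.X k) =
    Polynomial.C (MvPolynomial.X k) + Polynomial.C (sqOneX k) * Polynomial.X := by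
  simp [totalSq]

/-- The Cartan formula. -/
theorem sq_mul (i : ℕ) (f g : J) :
    sq i (f * g) = ∑ p ∈ Finset.HasAntidiagonal.antidiagonal i, sq p.1 f * sq p.2 g := by
  simp [sq_apply, Polynomial.coeff_mul]

theorem sq_zero : sq 0 = LinearMap.id := by
  have h : ((Polynomial.aeval (R := J) (0 : J)).restrictScalars (ZMod 2)).comp totalSq =
      AlgHom.id (ZMod 2) J := by
    ext k : 1
    simp [totalSq_X]
  refine LinearMap.ext fun f => ?_
  have := DFunLike.congr_fun h f
  simpa [sq_apply, Polynomial.coeff_zero_eq_aeval_zero] using this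

theorem sq_one_X_zero : sq 1 (MvPolynomial.X 0) = 0 := by
  simp [sq_apply, totalSq_X, sqOneX]

theorem sq_one_X_succ (k : ℕ) :
    sq 1 (MvPolynomial.X (k + 1)) = MvPolynomial.X k ^ 2 := by
  rw [sq_apply, totalSq_X]
  simp [sqOneX, -map_pow]

/-- Instability. -/
theorem sq_eq_zero_of_lt {n d i : ℕ} {f : J} (hf : f ∈ piece n d) (h : d < i) : sq i f = 0 := by
  have key : ∀ s : ℕ →₀ ℕ, (totalSq (MvPolynomial.monomial s 1)).natDegree ≤ s.sum fun _ e => e := by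
    intro s
    rw [MvPolynomial.monomial_eq, map_mul, Finsupp.prod, map_prod]
    simp only [map_pow, totalSq_X, map_one, one_mul]
    refine (Polynomial.natDegree_prod_le _ _).trans (Finset.sum_le_sum fun k _ => ?_)
    refine Polynomial.natDegree_pow_le.trans ?_
    have : (Polynomial.C (MvPolynomial.X k : J) + Polynomial.C (sqOneX k) * Polynomial.X).natDegree
        ≤ 1 := by compute_degree
    exact (Nat.mul_le_mul_left _ this).trans (by simp)
  rw [f.as_sum, map_sum]
  refine Finset.sum_eq_zero fun s hs => ?_
  have hw := hf (MvPolynomial.mem_support_iff.mp hs)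
  have hd : (s.sum fun _ e => e) = d := by
    have := congrArg Prod.snd hw
    rw [Finsupp.weight_apply] at this
    simpa [Finsupp.sum, Prod.snd_sum] using this
  have h1 : MvPolynomial.monomial s (f.coeff s)
      = f.coeff s • (MvPolynomial.monomial s 1 : J) := by
    rw [MvPolynomial.smul_monomial]; simp
  rw [h1, map_smul, sq_apply,
    Polynomial.coeff_eq_zero_of_natDegree_lt ((key s).trans_lt (by omega)), smul_zero]

/-- The squares are determined by `Sq^0 = 1`, the Cartan formula, instability, and `Sq^1 x_k`. -/
theorem sq_unique (S : ℕ → Module.End (ZMod 2) J) (h0 : S 0 = LinearMap.id)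
    (hmul : ∀ i f g, S i (f * g) = ∑ p ∈ Finset.HasAntidiagonal.antidiagonal i, S p.1 f * S p.2 g)
    (hun : ∀ n d i f, f ∈ piece n d → d < i → S i f = 0)
    (h10 : S 1 (MvPolynomial.X 0) = 0)
    (h1 : ∀ k, S 1 (MvPolynomial.X (k + 1)) = MvPolynomial.X k ^ 2) : S = sq := by
  have hX : ∀ k i, S i (MvPolynomial.X k) = sq i (MvPolynomial.X k) := by
    intro k i
    have hk : (MvPolynomial.X k : J) ∈ piece (2 ^ k) 1 :=
      MvPolynomial.isWeightedHomogeneous_X _ _ _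
    match i, k with
    | 0, _ => rw [h0, sq_zero]
    | 1, 0 => rw [h10, sq_one_X_zero]
    | 1, k + 1 => rw [h1, sq_one_X_succ]
    | i + 2, _ => rw [hun _ _ _ _ hk (by omega), sq_eq_zero_of_lt hk (by omega)]
  have h1' : ∀ i, S i 1 = sq i 1 := by
    intro i
    have hk : (1 : J) ∈ piece 0 0 := MvPolynomial.isWeightedHomogeneous_one _ _
    match i with
    | 0 => rw [h0, sq_zero]
    | i + 1 => rw [hun _ _ _ _ hk (by omega), sq_eq_zero_of_lt hk (by omega)]
  have main : ∀ f i, S i f = sq i f := by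
    intro f
    induction f using MvPolynomial.induction_on with
    | C a =>
      intro i
      rw [← mul_one (MvPolynomial.C a), ← MvPolynomial.smul_eq_C_mul, map_smul, map_smul, h1']
    | add p q hp hq => intro i; rw [map_add, map_add, hp, hq]
    | mul_X p k hp => intro i; simp only [hmul, sq_mul, hp, hX]
  funext i
  exact LinearMap.ext fun f => main f i

/-! ### The Milnor primitives -/

/-- The action of `Q_m` on `J(⋆)^*`, where `Q_0 = Sq^1` and `Q_m = [Q_{m-1}, Sq^{2^m}]`. -/
def Q : ℕ → Module.End (ZMod 2) J
  | 0 => sq 1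
  | m + 1 => ⁅Q m, sq (2 ^ (m + 1))⁆

/-! The next facts show that `Q_m` is a derivation of square zero, so that its homology is an
algebra. -/

/-- An auxiliary derivation, equal to `Q_m`. -/
def derQ (m : ℕ) : Derivation (ZMod 2) J J :=
  MvPolynomial.mkDerivation (ZMod 2) fun k =>
    if k ≤ m then 0 else MvPolynomial.X (k - m - 1) ^ 2 ^ (m + 1)

theorem derQ_X (m k : ℕ) : derQ m (MvPolynomial.X k) =
    if k ≤ m then 0 else MvPolynomial.X (k - m - 1) ^ 2 ^ (m + 1) := by
  simp [derQ, MvPolynomial.mkDerivation_X]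

theorem derQ_pow_two_mul (m n : ℕ) (f : J) : derQ m (f ^ (2 * n)) = 0 := by
  rw [Derivation.leibniz_pow, mul_smul, two_smul, CharTwo.add_self_eq_zero]

theorem derQ_sqOneX (m k : ℕ) : derQ m (sqOneX k) = 0 := by
  cases k with
  | zero => simp [sqOneX]
  | succ k => exact derQ_pow_two_mul m 1 _

theorem sqOneX_eq (k : ℕ) : derQ 0 (MvPolynomial.X k) = sqOneX k := by
  cases k <;> simp [derQ_X, sqOneX]

theorem coeff_mul_of_derivation (D : Derivation (ZMod 2) J J) (f g : J) (i : ℕ) :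
    D (sq i (f * g)) = ∑ p ∈ Finset.HasAntidiagonal.antidiagonal i,
      (sq p.1 f * D (sq p.2 g) + D (sq p.1 f) * sq p.2 g) := by
  rw [sq_mul, map_sum]
  refine Finset.sum_congr rfl fun p _ => ?_
  rw [Derivation.leibniz, smul_eq_mul, smul_eq_mul, mul_comm (sq p.2 g)]

/-- `D` applied to the coefficients of the total square, as a map to polynomials. -/
def mapDer (D : Derivation (ZMod 2) J J) (f : J) : Polynomial J :=
  (totalSq f).sum fun i a => Polynomial.monomial i (D a)

theorem coeff_mapDer (D : Derivation (ZMod 2) J J) (f : J) (i : ℕ) :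
    (mapDer D f).coeff i = D (sq i f) := by
  simp only [mapDer, Polynomial.sum, Polynomial.finsetSum_coeff, Polynomial.coeff_monomial,
    sq_apply]
  rw [Finset.sum_ite_eq']
  split_ifs with h
  · rfl
  · rw [Polynomial.notMem_support_iff.mp h, map_zero]

theorem mapDer_add (D : Derivation (ZMod 2) J J) (f g : J) :
    mapDer D (f + g) = mapDer D f + mapDer D g := by
  ext1 i; simp [coeff_mapDer]

theorem mapDer_mul (D : Derivation (ZMod 2) J J) (f g : J) :
    mapDer D (f * g) = totalSq f * mapDer D g + mapDer D f * totalSq g := by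
  ext1 i
  rw [coeff_mapDer, coeff_mul_of_derivation, Polynomial.coeff_add, Polynomial.coeff_mul,
    Polynomial.coeff_mul, ← Finset.sum_add_distrib]
  simp only [coeff_mapDer, sq_apply]

theorem mapDer_X (m k : ℕ) :
    mapDer (derQ m) (MvPolynomial.X k) = Polynomial.C (derQ m (MvPolynomial.X k)) := by
  ext1 i
  rw [coeff_mapDer, sq_apply, totalSq_X]
  match i with
  | 0 => simp
  | 1 => simp [derQ_sqOneX]
  | i + 2 => simp

theorem totalSq_derQ (m : ℕ) (f : J) : totalSq (derQ m f) =
    mapDer (derQ m) f + Polynomial.X ^ 2 ^ (m + 1) * mapDer (derQ (m + 1)) f := by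
  induction f using MvPolynomial.induction_on with
  | C a =>
    have h : ∀ D : Derivation (ZMod 2) J J, mapDer D (MvPolynomial.C a) = 0 := by
      intro D
      ext1 i
      rw [coeff_mapDer, sq_apply]
      have : totalSq (MvPolynomial.C a) = Polynomial.C (MvPolynomial.C a) := by
        simp only [totalSq, MvPolynomial.aeval_C]; rfl
      rw [this, Polynomial.coeff_C]
      split_ifs <;> simp
    simp [h]
  | add p q hp hq => rw [map_add, map_add, hp, hq, mapDer_add, mapDer_add]; ring
  | mul_X p k hp =>
    have hX : totalSq (derQ m (MvPolynomial.X k)) = mapDer (derQ m) (MvPolynomial.X k)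
        + Polynomial.X ^ 2 ^ (m + 1) * mapDer (derQ (m + 1)) (MvPolynomial.X k) := by
      rw [mapDer_X, mapDer_X, derQ_X, derQ_X]
      rcases Nat.lt_trichotomy k (m + 1) with h | h | h
      · rw [if_pos (by omega), if_pos (by omega)]; simp
      · rw [if_neg (by omega), if_pos (by omega), map_pow, totalSq_X,
          show k - m - 1 = 0 by omega]
        simp [sqOneX]
      · obtain ⟨j, rfl⟩ : ∃ j, k = m + 2 + j := ⟨k - (m + 2), by omega⟩
        rw [if_neg (by omega), if_neg (by omega), map_pow, totalSq_X,
          show m + 2 + j - m - 1 = j + 1 by omega, show m + 2 + j - (m + 1) - 1 = j by omega,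
          add_pow_char_pow, mul_pow, sqOneX, ← Polynomial.C_pow, ← Polynomial.C_pow, ← pow_mul,
          ← pow_succ', mul_comm]
    rw [Derivation.leibniz, map_add, smul_eq_mul, smul_eq_mul, map_mul, map_mul, hp, hX,
      mapDer_mul, mapDer_mul]
    ring

theorem Q_eq_derQ (m : ℕ) (f : J) : Q m f = derQ m f := by
  induction m generalizing f with
  | zero =>
    change sq 1 f = _
    induction f using MvPolynomial.induction_on with
    | C a =>
      rw [sq_apply]
      have : totalSq (MvPolynomial.C a) = Polynomial.C (MvPolynomial.C a) := by
        simp only [totalSq, MvPolynomial.aeval_C]; rfl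
      simp [this]
    | add p q hp hq => rw [map_add, map_add, hp, hq]
    | mul_X p k hp =>
      have h1 : sq 1 (MvPolynomial.X k) = sqOneX k := by
        simp [sq_apply, totalSq_X, Polynomial.coeff_C]
      rw [sq_mul, Finset.Nat.antidiagonal_succ]
      simp [sq_zero, hp, h1, sqOneX_eq, mul_comm]
  | succ m ih =>
    have h := congrArg (fun P => Polynomial.coeff P (2 ^ (m + 1))) (totalSq_derQ m f)
    simp only [Polynomial.coeff_add] at h
    rw [Polynomial.coeff_X_pow_mul', if_pos le_rfl, Nat.sub_self, coeff_mapDer, coeff_mapDer,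
      sq_zero, ← sq_apply] at h
    change ⁅Q m, sq (2 ^ (m + 1))⁆ f = _
    rw [Ring.lie_def, LinearMap.sub_apply, Module.End.mul_apply, Module.End.mul_apply, ih, ih, h,
      LinearMap.id_apply, sub_add_cancel_left, CharTwo.neg_eq]

theorem Q_mul (m : ℕ) (f g : J) : Q m (f * g) = f * Q m g + Q m f * g := by
  simp only [Q_eq_derQ, Derivation.leibniz, smul_eq_mul]
  ring

theorem Q_Q (m : ℕ) (f : J) : Q m (Q m f) = 0 := by
  induction f using MvPolynomial.induction_on with
  | C a => simp [Q_eq_derQ]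
  | add p q hp hq => simp [hp, hq]
  | mul_X p k hp =>
    have hX : Q m (Q m (MvPolynomial.X k)) = 0 := by
      rw [Q_eq_derQ, Q_eq_derQ, derQ_X]
      split_ifs
      · simp
      · rw [pow_succ', derQ_pow_two_mul]
    rw [Q_mul, map_add, Q_mul, Q_mul, hp, hX, mul_zero, zero_mul, zero_add, add_zero,
      CharTwo.add_self_eq_zero]

/-! ### Margolis homology -/

/-- The cycles `ker Q_m`, a subalgebra of `J(⋆)^*`. -/
def cycles (m : ℕ) : Subalgebra (ZMod 2) J where
  carrier := {f | Q m f = 0}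
  mul_mem' {f g} hf hg := by
    have hf' : Q m f = 0 := hf
    have hg' : Q m g = 0 := hg
    change Q m (f * g) = 0
    rw [Q_mul, hf', hg', mul_zero, zero_mul, add_zero]
  add_mem' {f g} hf hg := by
    have hf' : Q m f = 0 := hf
    have hg' : Q m g = 0 := hg
    change Q m (f + g) = 0
    rw [map_add, hf', hg', add_zero]
  algebraMap_mem' a := by
    change Q m _ = 0
    rw [Q_eq_derQ, Derivation.map_algebraMap]

theorem Q_mem_cycles (m : ℕ) (f : J) : Q m f ∈ cycles m := Q_Q m f

/-- The boundaries `im Q_m`, an ideal of `ker Q_m`. -/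
def boundaries (m : ℕ) : Ideal (cycles m) where
  carrier := {z | ∃ f : J, Q m f = (z : J)}
  add_mem' := by
    rintro a b ⟨f, hf⟩ ⟨g, hg⟩
    exact ⟨f + g, by rw [map_add, hf, hg, Subalgebra.coe_add]⟩
  zero_mem' := ⟨0, by simp⟩
  smul_mem' := by
    rintro ⟨c, hc⟩ z ⟨f, hf⟩
    refine ⟨c * f, ?_⟩
    have hc' : Q m c = 0 := hc
    rw [Q_mul, hc', zero_mul, add_zero, hf]
    rfl

/-- The Margolis homology `H(J(⋆)^*; Q_m) = ker Q_m / im Q_m`, an algebra over `𝔽₂`. -/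
abbrev MargolisHomology (m : ℕ) : Type := cycles m ⧸ boundaries m

/-- The part of `H(J(⋆)^*; Q_m)` in bidegree `(n, d)`, that is `H(J(n); Q_m)^d`: the classes of
the cycles in `J(n)^d`. -/
def homologyPiece (m n d : ℕ) : Submodule (ZMod 2) (MargolisHomology m) :=
  ((piece n d).comap (cycles m).val.toLinearMap).map
    (Ideal.Quotient.mkₐ (ZMod 2) (boundaries m)).toLinearMap

/-! ### The answer -/

/-- The subalgebra `𝔽₂[x_0, …, x_m, x_{m+1}^2, x_{m+2}^2, …]` of `J(⋆)^*`. -/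
def R (m : ℕ) : Subalgebra (ZMod 2) J :=
  Algebra.adjoin (ZMod 2)
    ({f | ∃ k, k ≤ m ∧ f = MvPolynomial.X k} ∪ {f | ∃ k, m < k ∧ f = MvPolynomial.X k ^ 2})

/-- The ideal `(x_k^{2^{m+1}} | k ≥ 0)` of `R m`. -/
def truncationIdeal (m : ℕ) : Ideal (R m) :=
  Ideal.span {r | ∃ k, (r : J) = MvPolynomial.X k ^ 2 ^ (m + 1)}

/-- The part of `R m ⧸ truncationIdeal m` in bidegree `(n, d)`. -/
def quotientPiece (m n d : ℕ) : Submodule (ZMod 2) (R m ⧸ truncationIdeal m) :=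
  ((piece n d).comap (R m).val.toLinearMap).map
    (Ideal.Quotient.mkₐ (ZMod 2) (truncationIdeal m)).toLinearMap

end

end BrownGitler

namespace BrownGitler

open MvPolynomial

noncomputable section

/-! Write `q = 2 ^ (m + 1)`. The operator `Q_m` is the derivation `∑ j, x_j^q ∂/∂x_{j+m+1}`, so `J`
behaves like a Koszul complex whose `j`-th differential exchanges a factor `x_{j+m+1}` for `x_j^q`.
Reversing the `k`-th exchange gives `homotopy m k`, and `derQ_homotopy` shows that `proj m k` is
chain homotopic to the identity.

Surjectivity: applying `proj m k` for all `k` below a bound on the variables of a cycle replaces it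
by a homologous cycle with even exponents at every index above `m`, that is, by an element of `R m`
(`exists_homologous_mem_R`). Each projection only deletes monomials, so bidegrees are preserved.

Injectivity: every monomial of a boundary is divisible by some `x_k^q`, and for elements of `R m`
this forces membership in `truncationIdeal m` (`truncationIdeal_eq_comap`). -/

/-! ### Splitting `Q_m` into commuting one-variable differentials -/

/-- The summand of `Q_m` that differentiates along `x_{j+m+1}`. -/
def partQ (m j : ℕ) : Derivation (ZMod 2) J J :=
  (X j ^ 2 ^ (m + 1) : J) • pderiv (j + (m + 1))

theorem partQ_monomial (m j : ℕ) (u : ℕ →₀ ℕ) :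
    partQ m j (monomial u 1) =
      if Odd (u (j + (m + 1))) then
        monomial (u - Finsupp.single (j + (m + 1)) 1 + Finsupp.single j (2 ^ (m + 1))) 1
      else 0 := by
  rw [partQ, Derivation.smul_apply, pderiv_monomial, smul_eq_mul, X_pow_eq_monomial,
    monomial_mul, add_comm]
  split_ifs with h
  · rw [ZMod.natCast_eq_one_iff_odd.mpr h]; simp
  · rw [ZMod.natCast_eq_zero_iff_even.mpr (Nat.not_odd_iff_even.mp h)]; simp

theorem partQ_X (m j k : ℕ) :
    partQ m j (X k) = if k = j + (m + 1) then X j ^ 2 ^ (m + 1) else 0 := by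
  rw [partQ, Derivation.smul_apply, pderiv_X, Pi.single_apply, smul_eq_mul, mul_ite, mul_one,
    mul_zero]

theorem sum_partQ_apply (m : ℕ) (s : Finset ℕ) (f : J) :
    (∑ j ∈ s, partQ m j) f = ∑ j ∈ s, partQ m j f := by
  rw [← Derivation.coeFnAddMonoidHom_apply, map_sum, Finset.sum_apply]
  rfl

/-- The full sum over `j` is infinite, but a derivation is determined on `f` by its values on the
variables of `f`, and `x_i` is moved only by the summand `j = i - m - 1 < N`. -/
theorem derQ_eq_sum_partQ (m : ℕ) {f : J} {N : ℕ} (hN : ∀ i ∈ f.vars, i < N) :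
    derQ m f = ∑ j ∈ Finset.range N, partQ m j f := by
  have h : derQ m f = (∑ j ∈ Finset.range N, partQ m j) f := by
    refine derivation_eq_of_forall_mem_vars fun i hi => ?_
    have hi' := hN i hi
    rw [sum_partQ_apply, derQ_X]
    simp only [partQ_X]
    split_ifs with hm
    · exact (Finset.sum_eq_zero fun j _ => if_neg (by omega)).symm
    · rw [Finset.sum_eq_single (i - m - 1), if_pos (by omega)]
      · exact fun j _ hj => if_neg (by omega)
      · exact fun hj => absurd (Finset.mem_range.mpr (by omega)) hj
  rw [h, sum_partQ_apply]

/-! ### Chain homotopies from the identity to the projections -/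

/-- The homotopy that divides by `x_k ^ 2 ^ (m + 1)` and multiplies by `x_{k+m+1}`. -/
def homotopy (m k : ℕ) : J →ₗ[ZMod 2] J :=
  (basisMonomials ℕ (ZMod 2)).constr (ZMod 2) fun u =>
    if 2 ^ (m + 1) ≤ u k ∧ ¬ Odd (u (k + (m + 1))) then
      monomial (u - Finsupp.single k (2 ^ (m + 1)) + Finsupp.single (k + (m + 1)) 1) 1
    else 0

theorem homotopy_monomial (m k : ℕ) (u : ℕ →₀ ℕ) :
    homotopy m k (monomial u 1) =
      if 2 ^ (m + 1) ≤ u k ∧ ¬ Odd (u (k + (m + 1))) then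
        monomial (u - Finsupp.single k (2 ^ (m + 1)) + Finsupp.single (k + (m + 1)) 1) 1
      else 0 := by
  exact (basisMonomials ℕ (ZMod 2)).constr_basis (ZMod 2) _ u

/-- The projection onto the monomials whose exponent at `k` is less than `2 ^ (m + 1)` and whose
exponent at `k + m + 1` is even. -/
def proj (m k : ℕ) : J →ₗ[ZMod 2] J :=
  (basisMonomials ℕ (ZMod 2)).constr (ZMod 2) fun u =>
    if u k < 2 ^ (m + 1) ∧ ¬ Odd (u (k + (m + 1))) then monomial u 1 else 0

theorem proj_monomial (m k : ℕ) (u : ℕ →₀ ℕ) :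
    proj m k (monomial u 1) =
      if u k < 2 ^ (m + 1) ∧ ¬ Odd (u (k + (m + 1))) then monomial u 1 else 0 := by
  exact (basisMonomials ℕ (ZMod 2)).constr_basis (ZMod 2) _ u

theorem coeff_proj (m k : ℕ) (f : J) (u : ℕ →₀ ℕ) :
    (proj m k f).coeff u =
      if u k < 2 ^ (m + 1) ∧ ¬ Odd (u (k + (m + 1))) then f.coeff u else 0 := by
  have h : lcoeff (ZMod 2) u ∘ₗ proj m k =
      if u k < 2 ^ (m + 1) ∧ ¬ Odd (u (k + (m + 1))) then lcoeff (ZMod 2) u else 0 := by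
    refine (basisMonomials ℕ (ZMod 2)).ext fun v => ?_
    rw [coe_basisMonomials, LinearMap.comp_apply, proj_monomial]
    by_cases huv : v = u
    · subst huv; split_ifs <;> simp
    · split_ifs <;> simp [lcoeff_apply, coeff_monomial, huv]
  have := DFunLike.congr_fun h f
  rw [LinearMap.comp_apply, lcoeff_apply] at this
  rw [this]
  split_ifs <;> rfl

theorem two_dvd_two_pow_succ (m : ℕ) : 2 ∣ 2 ^ (m + 1) := dvd_pow_self 2 m.succ_ne_zero

/-- The two operators may share a variable, when `j = k + m + 1` or `k = j + m + 1`. They still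
commute because `2 ^ (m + 1)` is even: shifting an exponent by it preserves parity, and an odd `u k`
is at least `2 ^ (m + 1)` exactly when `u k - 1` is. -/
theorem partQ_homotopy_of_ne (m : ℕ) {j k : ℕ} (hjk : j ≠ k) (f : J) :
    partQ m j (homotopy m k f) = homotopy m k (partQ m j f) := by
  have h : (partQ m j : J →ₗ[ZMod 2] J) ∘ₗ homotopy m k =
      homotopy m k ∘ₗ (partQ m j : J →ₗ[ZMod 2] J) := by
    refine (basisMonomials ℕ (ZMod 2)).ext fun u => ?_
    have hq := two_dvd_two_pow_succ m
    have hpos := Nat.two_pow_pos (m + 1)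
    simp only [coe_basisMonomials, LinearMap.comp_apply, Derivation.coeFn_coe, homotopy_monomial,
      partQ_monomial]
    split_ifs with hk hj hj
    · have hk2 := Nat.not_odd_iff.mp hk.2
      have hj' := Nat.odd_iff.mp hj
      rw [partQ_monomial, homotopy_monomial, if_pos, if_pos]
      · congr 2
        ext i
        simp only [Finsupp.add_apply, Finsupp.tsub_apply, Finsupp.single_apply]
        split_ifs <;> subst_vars <;> omega
      · simp only [Finsupp.add_apply, Finsupp.tsub_apply, Finsupp.single_apply, Nat.odd_iff]
        split_ifs <;> subst_vars <;> omega
      · simp only [Finsupp.add_apply, Finsupp.tsub_apply, Finsupp.single_apply, Nat.odd_iff]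
        split_ifs <;> subst_vars <;> omega
    · have hk2 := Nat.not_odd_iff.mp hk.2
      have hj' := Nat.not_odd_iff.mp hj
      rw [partQ_monomial, if_neg, map_zero]
      simp only [Finsupp.add_apply, Finsupp.tsub_apply, Finsupp.single_apply, Nat.odd_iff]
      split_ifs <;> subst_vars <;> omega
    · have hj' := Nat.odd_iff.mp hj
      rw [Nat.odd_iff] at hk
      rw [homotopy_monomial, if_neg, map_zero]
      simp only [Finsupp.add_apply, Finsupp.tsub_apply, Finsupp.single_apply, Nat.odd_iff]
      split_ifs <;> subst_vars <;> omega
    · rw [map_zero, map_zero]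
  exact DFunLike.congr_fun h f

/-- On a monomial with odd exponent at `k + m + 1` the second composite is the identity and the
first vanishes. With that exponent even, the first is the identity if `x_k ^ 2 ^ (m + 1)` divides,
and otherwise both vanish and `proj` fixes the monomial. -/
theorem partQ_homotopy_self (m k : ℕ) (f : J) :
    partQ m k (homotopy m k f) + homotopy m k (partQ m k f) = f - proj m k f := by
  have h : (partQ m k : J →ₗ[ZMod 2] J) ∘ₗ homotopy m k + homotopy m k ∘ₗ (partQ m k : J →ₗ[ZMod 2] J) =
      LinearMap.id - proj m k := by
    refine (basisMonomials ℕ (ZMod 2)).ext fun u => ?_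
    simp only [coe_basisMonomials, LinearMap.comp_apply, Derivation.coeFn_coe,
      LinearMap.add_apply, LinearMap.sub_apply, LinearMap.id_apply, homotopy_monomial, partQ_monomial, proj_monomial]
    by_cases ho : Odd (u (k + (m + 1)))
    · have ho' := Nat.odd_iff.mp ho
      rw [if_neg (by tauto), if_pos ho, if_neg (by tauto), map_zero, zero_add, sub_zero,
        homotopy_monomial, if_pos]
      · congr 2
        ext i
        simp only [Finsupp.add_apply, Finsupp.tsub_apply, Finsupp.single_apply]
        split_ifs <;> subst_vars <;> omega
      · simp only [Finsupp.add_apply, Finsupp.tsub_apply, Finsupp.single_apply, Nat.odd_iff]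
        split_ifs <;> omega
    · have ho' := Nat.not_odd_iff.mp ho
      rw [if_neg ho, map_zero, add_zero]
      by_cases hk : 2 ^ (m + 1) ≤ u k
      · rw [if_pos ⟨hk, ho⟩, if_neg (by omega), sub_zero, partQ_monomial, if_pos]
        · congr 2
          ext i
          simp only [Finsupp.add_apply, Finsupp.tsub_apply, Finsupp.single_apply]
          split_ifs <;> subst_vars <;> omega
        · simp only [Finsupp.add_apply, Finsupp.tsub_apply, Finsupp.single_apply, Nat.odd_iff]
          split_ifs <;> omega
      · rw [if_neg (by tauto), if_pos ⟨by omega, ho⟩, map_zero, sub_self]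
  exact DFunLike.congr_fun h f

theorem derQ_homotopy (m k : ℕ) (f : J) :
    derQ m (homotopy m k f) + homotopy m k (derQ m f) = f - proj m k f := by
  -- One bound for `f`, its image and `k`, so that both sums run over the same range and include the
  -- term `k`.
  obtain ⟨N, hN⟩ : ∃ N, ∀ i ∈ insert k ((homotopy m k f).vars ∪ f.vars), i < N :=
    ⟨_, fun i hi => Nat.lt_succ_of_le (Finset.le_sup (f := id) hi)⟩
  rw [derQ_eq_sum_partQ m (N := N) fun i hi => hN i (by simp [hi]),
    derQ_eq_sum_partQ m (f := f) (N := N) fun i hi => hN i (by simp [hi]), map_sum,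
    ← Finset.sum_add_distrib, Finset.sum_eq_single k, partQ_homotopy_self]
  · intro j _ hj
    -- Commuting suffices for the cross terms: in characteristic 2 the two equal summands cancel.
    rw [partQ_homotopy_of_ne m hj, CharTwo.add_self_eq_zero]
  · exact fun h => absurd (Finset.mem_range.mpr (hN k (by simp))) h

/-! ### Cycles are homologous to elements of `R m` -/

/-- The support inclusion keeps parities already made even and later controls the bidegree. Only the
parity condition of `proj` is recorded, since surjectivity needs no bound on the exponents. -/
theorem exists_homologous_even (m : ℕ) {z : J} (hz : derQ m z = 0) (N : ℕ) :
    ∃ r f : J, derQ m r = 0 ∧ r.support ⊆ z.support ∧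
      (∀ u ∈ r.support, ∀ k < N, ¬ Odd (u (k + (m + 1)))) ∧ derQ m f = z - r := by
  induction N with
  | zero => exact ⟨z, 0, hz, subset_rfl, by simp, by simp⟩
  | succ N ih =>
    obtain ⟨r, f, hr, hs, he, hf⟩ := ih
    have key := derQ_homotopy m N r
    rw [hr, map_zero, add_zero] at key
    have hsupp : ∀ u ∈ (proj m N r).support, u ∈ r.support ∧ ¬ Odd (u (N + (m + 1))) := by
      intro u hu
      rw [mem_support_iff, coeff_proj] at hu
      split_ifs at hu with h
      · exact ⟨mem_support_iff.mpr hu, h.2⟩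
      · exact absurd rfl hu
    refine ⟨proj m N r, f + homotopy m N r, ?_, fun u hu => hs (hsupp u hu).1, ?_, ?_⟩
    -- The projection differs from the cycle `r` by a boundary, hence is a cycle since `Q_m` squares
    -- to zero.
    · rw [show proj m N r = r - derQ m (homotopy m N r) by rw [key]; abel, map_sub, hr,
        ← Q_eq_derQ, ← Q_eq_derQ, Q_Q, sub_zero]
    · intro u hu k hk
      rcases Nat.lt_succ_iff_lt_or_eq.mp hk with h | rfl
      · exact he u (hsupp u hu).1 k h
      · exact (hsupp u hu).2
    · rw [map_add, hf, key]; abel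

theorem X_mem_R {m k : ℕ} (h : k ≤ m) : (X k : J) ∈ R m :=
  Algebra.subset_adjoin (Or.inl ⟨k, h, rfl⟩)

theorem X_sq_mem_R (m k : ℕ) : (X k ^ 2 : J) ∈ R m := by
  rcases le_or_gt k m with h | h
  · exact pow_mem (X_mem_R h) 2
  · exact Algebra.subset_adjoin (Or.inr ⟨k, h, rfl⟩)

theorem X_pow_mem_R (m k : ℕ) : (X k ^ 2 ^ (m + 1) : J) ∈ R m := by
  rw [pow_succ', pow_mul]
  exact pow_mem (X_sq_mem_R m k) _

theorem monomial_mem_R {m : ℕ} {u : ℕ →₀ ℕ} (hu : ∀ k, ¬ Odd (u (k + (m + 1)))) (a : ZMod 2) :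
    monomial u a ∈ R m := by
  rw [monomial_eq, ← smul_eq_C_mul]
  refine (R m).smul_mem (prod_mem fun k _ => ?_) a
  change X k ^ u k ∈ R m
  rcases le_or_gt k m with h | h
  · exact pow_mem (X_mem_R h) _
  · have hk := hu (k - (m + 1))
    rw [Nat.sub_add_cancel h, Nat.not_odd_iff_even, even_iff_two_dvd] at hk
    obtain ⟨c, hc⟩ := hk
    rw [hc, pow_mul]
    exact pow_mem (X_sq_mem_R m k) c

/-- Even exponents above index `m` persist under products because exponents add, so `R m` is spanned
by monomials and membership can be read off the support. -/
theorem mem_R_iff {m : ℕ} {f : J} :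
    f ∈ R m ↔ ∀ u ∈ f.support, ∀ k, ¬ Odd (u (k + (m + 1))) := by
  classical
  refine ⟨fun hf => ?_, fun h => ?_⟩
  · induction hf using Algebra.adjoin_induction with
    | mem f hf =>
      rcases hf with ⟨j, hj, rfl⟩ | ⟨j, hj, rfl⟩ <;> intro u hu k
      · rw [support_X, Finset.mem_singleton] at hu
        rw [hu, Finsupp.single_apply, if_neg (by omega)]
        decide
      · rw [support_X_pow, Finset.mem_singleton] at hu
        rw [hu, Finsupp.single_apply]
        split_ifs <;> decide
    | algebraMap a =>
      intro u hu k
      rw [algebraMap_eq, mem_support_iff, coeff_C] at hu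
      split_ifs at hu with h
      · simp [← h]
      · exact absurd rfl hu
    | add f g _ _ hf hg =>
      intro u hu
      rcases Finset.mem_union.mp (support_add hu) with h | h
      · exact hf u h
      · exact hg u h
    | mul f g _ _ hf hg =>
      intro u hu k
      obtain ⟨v, hv, w, hw, rfl⟩ := Finset.mem_add.mp (support_mul f g hu)
      have h1 := hf v hv k
      have h2 := hg w hw k
      rw [Nat.not_odd_iff_even] at h1 h2 ⊢
      exact h1.add h2
  · rw [f.as_sum]
    exact sum_mem fun u hu => monomial_mem_R (h u hu) _

theorem exists_homologous_mem_R (m : ℕ) {z : J} (hz : derQ m z = 0) :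
    ∃ r f : J, r ∈ R m ∧ r.support ⊆ z.support ∧ derQ m f = z - r := by
  obtain ⟨N, hN⟩ : ∃ N, ∀ i ∈ z.vars, i < N :=
    ⟨_, fun i hi => Nat.lt_succ_of_le (Finset.le_sup (f := id) hi)⟩
  obtain ⟨r, f, -, hs, he, hf⟩ := exists_homologous_even m hz N
  refine ⟨r, f, mem_R_iff.mpr fun u hu k => ?_, hs, hf⟩
  rcases lt_or_ge k N with hk | hk
  · exact he u hu k hk
  -- Past the bound the variable does not occur in `z`, hence not in `r`, whose support is smaller.
  · rw [show u (k + (m + 1)) = 0 by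
      by_contra h
      have := hN _ ((mem_vars_iff_mem_support _).mpr ⟨u, hs hu, Finsupp.mem_support_iff.mpr h⟩)
      omega]
    decide

/-! ### Boundaries inside `R m` -/

/-- The values of `derQ m` on variables lie in the monomial ideal of `J` generated by the `x_k ^ 2 ^
(m + 1)`, so by the Leibniz rule all its values do. -/
theorem exists_le_of_mem_support_derQ (m : ℕ) (f : J) {u : ℕ →₀ ℕ}
    (hu : u ∈ (derQ m f).support) : ∃ k, 2 ^ (m + 1) ≤ u k := by
  have hmem : derQ m f ∈ Ideal.span ((fun s => monomial s (1 : ZMod 2)) ''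
      Set.range fun k : ℕ => Finsupp.single k (2 ^ (m + 1))) := by
    clear hu
    induction f using MvPolynomial.induction_on with
    | C a => rw [← algebraMap_eq, Derivation.map_algebraMap]; exact zero_mem _
    | add p q hp hq => rw [map_add]; exact add_mem hp hq
    | mul_X p k hp =>
      rw [Derivation.leibniz, smul_eq_mul, smul_eq_mul, derQ_X]
      refine add_mem (Ideal.mul_mem_left _ _ ?_) (Ideal.mul_mem_left _ _ hp)
      split_ifs
      · exact zero_mem _
      · exact Ideal.subset_span ⟨_, ⟨_, rfl⟩, (X_pow_eq_monomial ..).symm⟩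
  obtain ⟨_, ⟨k, rfl⟩, hk⟩ := mem_ideal_span_monomial_image.mp hmem u hu
  exact ⟨k, Finsupp.single_le_iff.mp hk⟩

/-- The ideal is taken in `R m`, so the cofactor must lie there too: removing the even power `x_k ^
2 ^ (m + 1)` from a monomial leaves its exponent parities unchanged. -/
theorem mem_truncationIdeal (m : ℕ) (r : R m)
    (hr : ∀ u ∈ (r : J).support, ∃ k, 2 ^ (m + 1) ≤ u k) : r ∈ truncationIdeal m := by
  have hR := mem_R_iff.mp r.2
  have hsum : r = ∑ u ∈ (r : J).support.attach,
      ⟨monomial u.1 ((r : J).coeff u.1), monomial_mem_R (hR u.1 u.2) _⟩ := by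
    refine Subtype.ext ?_
    rw [AddSubmonoidClass.coe_finsetSum,
      Finset.sum_attach _ fun u => monomial u ((r : J).coeff u)]
    exact (r : J).as_sum
  rw [hsum]
  refine sum_mem fun ⟨u, hu⟩ _ => ?_
  obtain ⟨k, hk⟩ := hr u hu
  have hq := two_dvd_two_pow_succ m
  have hv : ∀ j, ¬ Odd ((u - Finsupp.single k (2 ^ (m + 1)) : ℕ →₀ ℕ) (j + (m + 1))) := by
    intro j
    have := hR u hu j
    rw [Finsupp.tsub_apply, Finsupp.single_apply]
    rw [Nat.odd_iff] at this ⊢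
    split_ifs with h
    · subst h; omega
    · omega
  have h : (⟨monomial u ((r : J).coeff u), monomial_mem_R (hR u hu) _⟩ : R m) =
      ⟨_, monomial_mem_R hv ((r : J).coeff u)⟩ * ⟨_, X_pow_mem_R m k⟩ := by
    refine Subtype.ext ?_
    change monomial u _ = monomial _ _ * X k ^ 2 ^ (m + 1)
    rw [X_pow_eq_monomial, monomial_mul, mul_one,
      tsub_add_cancel_of_le (Finsupp.single_le_iff.mpr hk)]
  rw [h]
  exact Ideal.mul_mem_left _ _ (Ideal.subset_span ⟨k, rfl⟩)

theorem R_le_cycles (m : ℕ) : R m ≤ cycles m := by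
  refine Algebra.adjoin_le ?_
  rintro _ (⟨k, hk, rfl⟩ | ⟨k, hk, rfl⟩)
  · change Q m _ = 0
    rw [Q_eq_derQ, derQ_X, if_pos hk]
  · change Q m _ = 0
    rw [Q_eq_derQ]
    exact derQ_pow_two_mul m 1 _

theorem truncationIdeal_eq_comap (m : ℕ) : truncationIdeal m =
    (boundaries m).comap (Subalgebra.inclusion (R_le_cycles m)) := by
  refine le_antisymm (Ideal.span_le.mpr ?_) ?_
  · rintro r ⟨k, hk⟩
    -- Each generator is a boundary: `Q_m x_{k+m+1} = x_k ^ 2 ^ (m + 1)`.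
    refine ⟨X (k + (m + 1)), ?_⟩
    rw [Q_eq_derQ, derQ_X, if_neg (by omega), Subalgebra.coe_inclusion, hk]
    congr 2; omega
  · rintro r ⟨f, hf⟩
    rw [Q_eq_derQ, Subalgebra.coe_inclusion] at hf
    exact mem_truncationIdeal m r fun u hu => exists_le_of_mem_support_derQ m f (hf ▸ hu)

/-! ### The bigraded isomorphism -/

/-- The map to Margolis homology induced by the inclusion of `R m` in the cycles. -/
def toHomology (m : ℕ) : (R m ⧸ truncationIdeal m) →ₐ[ZMod 2] MargolisHomology m :=
  Ideal.quotientMapₐ (boundaries m) (Subalgebra.inclusion (R_le_cycles m))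
    (truncationIdeal_eq_comap m).le

theorem toHomology_mk (m : ℕ) (r : R m) : toHomology m (Ideal.Quotient.mk _ r) =
    Ideal.Quotient.mk (boundaries m) (Subalgebra.inclusion (R_le_cycles m) r) := rfl

theorem toHomology_injective (m : ℕ) : Function.Injective (toHomology m) :=
  Ideal.quotientMap_injective' (H := (truncationIdeal_eq_comap m).le) (truncationIdeal_eq_comap m).ge

theorem exists_toHomology_eq (m : ℕ) (z : cycles m) :
    ∃ r : R m, (r : J).support ⊆ (z : J).support ∧
      toHomology m (Ideal.Quotient.mk _ r) = Ideal.Quotient.mk _ z := by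
  have hz : derQ m (z : J) = 0 := by rw [← Q_eq_derQ]; exact z.2
  obtain ⟨r, f, hr, hs, hf⟩ := exists_homologous_mem_R m hz
  refine ⟨⟨r, hr⟩, hs, ?_⟩
  rw [toHomology_mk, eq_comm, Ideal.Quotient.eq]
  exact ⟨f, by rw [Q_eq_derQ, hf]; rfl⟩

theorem toHomology_bijective (m : ℕ) : Function.Bijective (toHomology m) := by
  refine ⟨toHomology_injective m, fun y => ?_⟩
  obtain ⟨z, rfl⟩ := Ideal.Quotient.mk_surjective y
  obtain ⟨r, -, h⟩ := exists_toHomology_eq m z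
  exact ⟨_, h⟩

theorem map_toHomology_quotientPiece (m n d : ℕ) :
    (quotientPiece m n d).map (toHomology m).toLinearMap = homologyPiece m n d := by
  refine le_antisymm ?_ ?_
  · rintro _ ⟨_, ⟨r, hr, rfl⟩, rfl⟩
    exact ⟨Subalgebra.inclusion (R_le_cycles m) r, hr, rfl⟩
  · rintro _ ⟨z, hz, rfl⟩
    obtain ⟨r, hs, h⟩ := exists_toHomology_eq m z
    -- Homogeneity is a condition on the support, so the representative `r` inherits the bidegree of
    -- `z`.
    exact ⟨_, ⟨r, fun u hu => hz (mem_support_iff.mp (hs (mem_support_iff.mpr hu))), rfl⟩, h⟩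

end

end BrownGitler

/-- For every `m ≥ 0` the inclusion of `𝔽₂[x_0, …, x_m, x_{m+1}^2, …]` in `J(⋆)^*` lands in the
cycles of `Q_m` and induces an isomorphism of bigraded algebras from
`𝔽₂[x_0, …, x_m, x_{m+1}^2, …] / (x_k^{2^{m+1}} | k ≥ 0)` to `H(J(⋆)^*; Q_m)`. -/
theorem proposition3p3 (m : ℕ) :
    ∃ (h : BrownGitler.R m ≤ BrownGitler.cycles m)
      (e : (BrownGitler.R m ⧸ BrownGitler.truncationIdeal m) ≃ₐ[ZMod 2]
        BrownGitler.MargolisHomology m),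
      (∀ r : BrownGitler.R m, e (Ideal.Quotient.mk (BrownGitler.truncationIdeal m) r) =
        Ideal.Quotient.mk (BrownGitler.boundaries m) (Subalgebra.inclusion h r)) ∧
      ∀ n d : ℕ, (BrownGitler.quotientPiece m n d).map e.toLinearMap =
        BrownGitler.homologyPiece m n d :=
  ⟨BrownGitler.R_le_cycles m,
    AlgEquiv.ofBijective (BrownGitler.toHomology m) (BrownGitler.toHomology_bijective m),
    BrownGitler.toHomology_mk m, BrownGitler.map_toHomology_quotientPiece m⟩
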